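/- Let $K\ge 2$ be an integer, let $\varepsilon>0$, and let $X$ be a regular $K$-ary tree, i.e. a rooted tree with root $0$ in which every vertex has exactly $K$ children (a child of $x$ is a neighbour of $x$ that is farther from the root than $x$). For a vertex $z$ let $|z|$ be its distance (number of edges) from the root; regard each edge as an interval of length $1$, and equip $X$ with the uniformizing metric $$d_X(x,y)=\int_{[x,y]}e^{-\varepsilon|z|}\,d|z| ,$$ where $[x,y]$ is the geodesic from $x$ to $y$. The boundary $\partial X$ is the set of infinite geodesics $0x_1x_2x_3\dots$ starting at the root (each $x_{i+1}$ being a child of $x_i$), with the visual metric $d_X(\zeta,\xi)=\int_{[\zeta,\xi]}e^{-\varepsilon|z|}\,d|z|$, the $d_X$-length of the infinite geodesic $[\zeta,\xi]$ joining $\zeta$ and $\xi$. Let $$Q=\frac{\log K}{\varepsilon}$$ be the Hausdorff dimension of $\partial X$, and let $\nu$ be the $Q$-dimensional Hausdorff measure on $\partial X$, normalized so that $\nu(\partial X)=1$. For $p\ge1$, $\theta>0$ and measurable $f:\partial X\to\mathbb R$ put $$E_p(f,t)=\biggl(\int_{\partial X}\frac{1}{\nu(B(\zeta,t))}\int_{B(\zeta,t)}|f(\zeta)-f(\xi)|^p\,d\nu(\xi)\,d\nu(\zeta)\biggr)^{1/p},\qquad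 \|f\|_{B^\theta_{p,p}(\partial X)}=\biggl(\int_0^\infty\Bigl(\frac{E_p(f,t)}{t^\theta}\Bigr)^p\frac{dt}{t}\biggr)^{1/p},$$ where $B(\zeta,t)$ is the open ball in $\partial X$, and let $B^\theta_{p,p}(\partial X)$ be the set of all $f\in L^p(\partial X,\nu)$ with $\|f\|_{B^\theta_{p,p}(\partial X)}<\infty$. **Proposition.** Let $p>1$. Every $u\in B^\theta_{p,p}(\partial X)$ has an $\alpha$-Hölder continuous representative, i.e. there are $v:\partial X\to\mathbb R$ and $C\ge 0$ with $v=u$ $\nu$-a.e. and $|v(\zeta)-v(\xi)|\le C\,d_X(\zeta,\xi)^\alpha$ for all $\zeta,\xi\in\partial X$, provided that one of the following conditions holds: (a) $Q<1$, $\theta\ge\dfrac{Q-1}{p}+1$ and $\alpha=1-\dfrac1p$; (b) $\dfrac Qp<\theta\le\dfrac{Q-1}{p}+1$, $\theta<1$ and $\alpha=\theta-\dfrac Qp$; (c) $Q\ge1$, $\theta\ge1$ and $0<\alpha<1-\dfrac Qp$. -/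

import Mathlib

open MeasureTheory Set
open scoped ENNReal NNReal

noncomputable section

namespace RootedTree

variable {V : Type*}

/-- `y` is a child of `x` in the graph `G` with root `o`: a neighbour of `x` that is one step
further away from the root than `x`. -/
def IsChild (G : SimpleGraph V) (o x y : V) : Prop :=
  G.Adj x y ∧ G.dist o y = G.dist o x + 1

/-- `G` with root `o` is a regular `K`-ary tree: a tree in which each vertex has exactly `K`
children. (For `K ≥ 1`, `ncard = K` says in particular that the set of children is finite.) -/
def IsRegularTree (G : SimpleGraph V) (o : V) (K : ℕ) : Prop :=
  G.IsTree ∧ ∀ x : V, {y : V | IsChild G o x y}.ncard = K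

/-- The boundary `∂X` of the tree `X` with root `o`: a point is an infinite geodesic
`o x₁ x₂ x₃ …` starting at the root, where each vertex is a child of the preceding one.
The parameter `ε` does not affect the points; it determines the metric put on `∂X` below. -/
structure Boundary (G : SimpleGraph V) (o : V) (ε : ℝ) where
  /-- the vertex of the geodesic at distance `n` from the root -/
  vertex : ℕ → V
  vertex_zero : vertex 0 = o
  isChild : ∀ n, IsChild G o (vertex n) (vertex (n + 1))

/-- The length `∫_{[x,y]} e^{-ε|z|} d|z|`, in the uniformizing metric, of an edge `[x,y]` that
joins a vertex `x` with `|x| = n` to a child `y`. -/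
def edgeLength (ε : ℝ) (n : ℕ) : ℝ :=
  ∫ t in (n : ℝ)..(n + 1), Real.exp (-ε * t)

theorem edgeLength_pos (ε : ℝ) (n : ℕ) : 0 < edgeLength ε n := by
  apply intervalIntegral.intervalIntegral_pos_of_pos
  · exact (by fun_prop : Continuous fun t : ℝ => Real.exp (-ε * t)).intervalIntegrable _ _
  · intro t
    exact Real.exp_pos _
  · linarith

theorem edgeLength_le {ε : ℝ} (hε : 0 < ε) (n : ℕ) : edgeLength ε n ≤ Real.exp (-ε) ^ n := by
  have h : ∀ t ∈ Icc (n : ℝ) (n + 1), Real.exp (-ε * t) ≤ Real.exp (-ε) ^ n := by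
    intro t ht
    rw [← Real.exp_nat_mul]
    apply Real.exp_le_exp.2
    nlinarith [ht.1]
  calc edgeLength ε n ≤ ∫ _ in (n : ℝ)..(n + 1), Real.exp (-ε) ^ n := by
        apply intervalIntegral.integral_mono_on (by linarith) _ _ h
        · exact (by fun_prop : Continuous fun t : ℝ => Real.exp (-ε * t)).intervalIntegrable _ _
        · exact continuous_const.intervalIntegrable _ _
    _ = Real.exp (-ε) ^ n := by simp

theorem summable_edgeLength {ε : ℝ} (hε : 0 < ε) : Summable (edgeLength ε) :=
  Summable.of_nonneg_of_le (fun n => (edgeLength_pos ε n).le) (edgeLength_le hε)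
    (summable_geometric_of_lt_one (Real.exp_pos _).le (by simpa using hε))

namespace Boundary

variable {G : SimpleGraph V} {o : V} {ε : ℝ}

open Classical in
/-- The joint contribution to the length of the infinite geodesic `[ζ, ξ]` of the `n`-th edge of
`ζ` and the `n`-th edge of `ξ`, which join level `n` to level `n + 1`. In a tree the two edges
coincide, and then are not part of `[ζ, ξ]`, if and only if they have the same endpoint at level
`n + 1`; otherwise both edges belong to `[ζ, ξ]`. -/
def edgeTerm (ζ ξ : Boundary G o ε) (n : ℕ) : ℝ :=
  if ζ.vertex (n + 1) = ξ.vertex (n + 1) then 0 else 2 * edgeLength ε n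

/-- The visual metric `d_X` on `∂X`: the distance `d_X(ζ, ξ) = ∫_{[ζ,ξ]} e^{-ε|z|} d|z|` is the
length, in the uniformizing metric, of the infinite geodesic `[ζ, ξ]`, i.e. the sum of the lengths
of its edges. -/
instance : Dist (Boundary G o ε) where
  dist ζ ξ := ∑' n, edgeTerm ζ ξ n

theorem edgeTerm_nonneg (ζ ξ : Boundary G o ε) (n : ℕ) : 0 ≤ edgeTerm ζ ξ n := by
  have := edgeLength_pos ε n
  unfold edgeTerm
  split_ifs <;> linarith

theorem summable_edgeTerm (hε : 0 < ε) (ζ ξ : Boundary G o ε) : Summable (edgeTerm ζ ξ) := by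
  refine Summable.of_nonneg_of_le (edgeTerm_nonneg ζ ξ) (fun n => ?_)
    ((summable_edgeLength hε).mul_left 2)
  have := edgeLength_pos ε n
  unfold edgeTerm
  split_ifs <;> linarith

instance [hε : Fact (0 < ε)] : MetricSpace (Boundary G o ε) where
  dist_self ζ := by
    change ∑' n, edgeTerm ζ ζ n = 0
    simp [edgeTerm]
  dist_comm ζ ξ := by
    change ∑' n, edgeTerm ζ ξ n = ∑' n, edgeTerm ξ ζ n
    refine tsum_congr fun n => ?_
    unfold edgeTerm
    by_cases b : ζ.vertex (n + 1) = ξ.vertex (n + 1)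
    · rw [if_pos b, if_pos b.symm]
    · rw [if_neg b, if_neg (Ne.symm b)]
  dist_triangle ζ ξ χ := by
    change ∑' n, edgeTerm ζ χ n ≤ ∑' n, edgeTerm ζ ξ n + ∑' n, edgeTerm ξ χ n
    have h1 := summable_edgeTerm hε.out ζ ξ
    have h2 := summable_edgeTerm hε.out ξ χ
    rw [← h1.tsum_add h2]
    refine (summable_edgeTerm hε.out ζ χ).tsum_le_tsum (fun n => ?_) (h1.add h2)
    have := edgeLength_pos ε n
    unfold edgeTerm
    by_cases b : ζ.vertex (n + 1) = ξ.vertex (n + 1)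
    · rw [b]
      simp
    · split_ifs <;> linarith
  eq_of_dist_eq_zero := by
    intro ζ ξ h
    change ∑' n, edgeTerm ζ ξ n = 0 at h
    have h0 := (hasSum_zero_iff_of_nonneg (edgeTerm_nonneg ζ ξ)).1
      (h ▸ (summable_edgeTerm hε.out ζ ξ).hasSum)
    have hv : ζ.vertex = ξ.vertex := by
      funext n
      cases n with
      | zero => rw [ζ.vertex_zero, ξ.vertex_zero]
      | succ n =>
        by_contra hne
        have h1 : edgeTerm ζ ξ n = 0 := congrFun h0 n
        have := edgeLength_pos ε n
        rw [edgeTerm, if_neg hne] at h1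
        linarith
    cases ζ
    cases ξ
    simpa using hv

instance [Fact (0 < ε)] : MeasurableSpace (Boundary G o ε) := borel _

instance [Fact (0 < ε)] : BorelSpace (Boundary G o ε) := ⟨rfl⟩

end Boundary

end RootedTree

namespace Besov

variable {Z : Type*} [MetricSpace Z] [MeasurableSpace Z] [BorelSpace Z]

/-- The normalized `Q`-dimensional Hausdorff measure on `Z` (a probability measure as soon as the
Hausdorff measure of `Z` is positive and finite). -/
def normalizedHausdorff (Z : Type*) [MetricSpace Z] [MeasurableSpace Z] [BorelSpace Z] (Q : ℝ) :
    Measure Z :=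
  (Measure.hausdorffMeasure Q (univ : Set Z))⁻¹ • Measure.hausdorffMeasure Q

/-- `E_p(f,t) = (∫_Z ⨍_{B(ζ,t)} |f(ζ) - f(ξ)|^p dν(ξ) dν(ζ))^{1/p}`, with values in `[0,∞]`. -/
def modulus (ν : Measure Z) (p : ℝ) (f : Z → ℝ) (t : ℝ) : ℝ≥0∞ :=
  (∫⁻ ζ, ⨍⁻ ξ in Metric.ball ζ t, ENNReal.ofReal (|f ζ - f ξ| ^ p) ∂ν ∂ν) ^ (1 / p)

/-- The Besov seminorm `(∫_0^∞ (E_p(f,t) / t^θ)^q dt/t)^{1/q}`, with values in `[0,∞]`. -/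
def seminorm (ν : Measure Z) (θ p q : ℝ) (f : Z → ℝ) : ℝ≥0∞ :=
  (∫⁻ t in Ioi (0 : ℝ),
    (modulus ν p f t / ENNReal.ofReal (t ^ θ)) ^ q / ENNReal.ofReal t) ^ (1 / q)

/-- `f` belongs to the Besov space `B^θ_{p,q}(Z)`: it is in `L^p(Z)` and has a finite Besov
seminorm. -/
def MemBesov (ν : Measure Z) (θ p q : ℝ) (f : Z → ℝ) : Prop :=
  MemLp f (ENNReal.ofReal p) ν ∧ seminorm ν θ p q f < ∞

end Besov

end

/-! Write `q = exp (-ε)` and let `u_n` be the average of `u` over cylinders of level `n`. Two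
geodesics that part at level `n` are at distance exactly `bound ε * q ^ n`, so balls are cylinders,
and the part of the Besov integral over radii between consecutive scales bounds the level-`n`
oscillation by `M * q ^ (n * θ * p)` (`exists_oscillation_le`). A self-similarity argument gives `ν
(cylinder n ζ) ≥ K ^ (-n) = q ^ (n * Q)`, so Jensen's inequality yields `|u_n - u_(n+1)| ≤ C * q ^
(n * (θ - Q / p))` at every point (`cylinderAverage_step_le`). In all three cases `0 < α ≤ θ - Q /
p`, so `u_n` converges uniformly at rate `q ^ (n * α)`. The limit equals `u` almost everywhere by
Fatou's lemma. It is Hölder because points that part at level `n` share the same `u_n`. -/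

namespace RootedTree

/-! ### Children and edge lengths -/

variable {V : Type*} {G : SimpleGraph V} {o : V} {ε : ℝ} {K : ℕ}

/-- In a tree, a vertex is the child of at most one vertex. -/
theorem IsChild.parent_unique (hG : G.IsTree) {a b y : V} (ha : IsChild G o a y)
    (hb : IsChild G o b y) : a = b := by
  have key : ∀ {c : V}, IsChild G o c y →
      ∃ w : G.Walk o y, w.IsPath ∧ w.penultimate = c := by
    intro c hc
    obtain ⟨w, hw⟩ := (hG.connected o c).exists_walk_length_eq_dist
    -- A shortest walk to `c` extended by the edge to `y` is again shortest, hence the unique path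
    -- from `o` to `y`.
    refine ⟨w.concat hc.1, ?_, by simp⟩
    apply SimpleGraph.Walk.isPath_of_length_eq_dist
    rw [SimpleGraph.Walk.length_concat, hw, hc.2]
  obtain ⟨w, hw, rfl⟩ := key ha
  obtain ⟨w', hw', rfl⟩ := key hb
  rw [(hG.existsUnique_path o y).unique hw hw']

theorem edgeLength_eq (ε : ℝ) (n : ℕ) :
    edgeLength ε n = Real.exp (-ε) ^ n * edgeLength ε 0 := by
  have h := intervalIntegral.integral_comp_add_right (a := 0) (b := 1)
    (fun t : ℝ => Real.exp (-ε * t)) (n : ℝ)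
  unfold edgeLength
  rw [zero_add, add_comm 1 (n : ℝ)] at h
  rw [← h, ← intervalIntegral.integral_const_mul, Nat.cast_zero, zero_add]
  refine intervalIntegral.integral_congr fun t _ => ?_
  rw [← Real.exp_nat_mul, ← Real.exp_add]
  ring_nf

/-- For each pair of vertices of a regular tree, a map from the children of the first to the
children of the second which is injective. -/
theorem IsRegularTree.exists_child_map (hK : 2 ≤ K) (hG : IsRegularTree G o K) :
    ∃ e : V → V → V → V, ∀ a b, (∀ y, IsChild G o a y → IsChild G o b (e a b y)) ∧
      InjOn (e a b) {y | IsChild G o a y} := by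
  have h : ∀ a b, ∃ f : V → V, (∀ y, IsChild G o a y → IsChild G o b (f y)) ∧
      InjOn f {y | IsChild G o a y} := by
    intro a b
    have hfin : ∀ x, {y | IsChild G o x y}.Finite := fun x =>
      finite_of_ncard_ne_zero (by rw [hG.2 x]; omega)
    have hcard : {y | IsChild G o a y}.encard ≤ {y | IsChild G o b y}.encard := by
      rw [← (hfin a).cast_ncard_eq, ← (hfin b).cast_ncard_eq, hG.2, hG.2]
    obtain ⟨f, hf, hinj⟩ :=
      @Set.Finite.exists_injOn_of_encard_le V V ⟨o⟩ _ _ (hfin a) hcard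
    exact ⟨f, fun y hy => hf hy, hinj⟩
  choose e he using h
  exact ⟨e, he⟩

/-! ### Metric and Hausdorff measure of cylinders -/

namespace Boundary

/-- The points of the boundary whose geodesics agree with that of `ζ` up to level `n`. -/
def cylinder (n : ℕ) (ζ : Boundary G o ε) : Set (Boundary G o ε) :=
  {ξ | ξ.vertex n = ζ.vertex n}

/-- The diameter of `∂X`. -/
noncomputable def bound (ε : ℝ) : ℝ := 2 * ∑' n, edgeLength ε n

theorem bound_pos (hε : 0 < ε) : 0 < bound ε :=
  mul_pos two_pos ((summable_edgeLength hε).tsum_pos (fun n => (edgeLength_pos ε n).le) 0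
    (edgeLength_pos ε 0))

theorem tsum_edgeLength_tail (ε : ℝ) (n : ℕ) :
    ∑' k, 2 * edgeLength ε (k + n) = bound ε * Real.exp (-ε) ^ n := by
  rw [bound, ← tsum_mul_left, ← tsum_mul_right]
  refine tsum_congr fun k => ?_
  rw [edgeLength_eq ε (k + n), edgeLength_eq ε k, pow_add]
  ring

theorem vertex_eq_of_le (hG : G.IsTree) {ζ ξ : Boundary G o ε} {m n : ℕ} (hmn : m ≤ n)
    (h : ζ.vertex n = ξ.vertex n) : ζ.vertex m = ξ.vertex m := by
  induction n, hmn using Nat.le_induction with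
  | base => exact h
  | succ n _ ih =>
    exact ih ((ζ.isChild n).parent_unique hG (h ▸ ξ.isChild n))

/-- The geodesics of distinct points of the boundary part at some level. -/
theorem exists_vertex_ne {ζ ξ : Boundary G o ε} (hne : ζ ≠ ξ) :
    ∃ n, ζ.vertex n = ξ.vertex n ∧ ζ.vertex (n + 1) ≠ ξ.vertex (n + 1) := by
  by_contra! h
  apply hne
  have hv : ζ.vertex = ξ.vertex := by
    funext n
    induction n with
    | zero => rw [ζ.vertex_zero, ξ.vertex_zero]
    | succ n ih => exact h n ih
  cases ζ
  cases ξ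
  simpa using hv

theorem dist_eq_tsum (ζ ξ : Boundary G o ε) : dist ζ ξ = ∑' n, edgeTerm ζ ξ n := rfl

/-- Guarantees that radii as in `ball_eq_cylinder` exist at each level. -/
theorem scale_lt_div (hε : 0 < ε) (n : ℕ) : bound ε * Real.exp (-ε) ^ n <
    bound ε * Real.exp (-ε) ^ n / Real.exp (-ε) := by
  have h1 : 0 < bound ε * Real.exp (-ε) ^ n :=
    mul_pos (bound_pos hε) (pow_pos (Real.exp_pos _) _)
  rw [lt_div_iff₀ (Real.exp_pos _)]
  exact mul_lt_of_lt_one_right h1 (by simpa using hε)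

section Metric

variable [hε : Fact (0 < ε)]

theorem dist_le_of_vertex_eq (hG : G.IsTree) {ζ ξ : Boundary G o ε} {n : ℕ}
    (h : ζ.vertex n = ξ.vertex n) : dist ζ ξ ≤ bound ε * Real.exp (-ε) ^ n := by
  have hs := summable_edgeTerm hε.out ζ ξ
  rw [dist_eq_tsum, ← hs.sum_add_tsum_nat_add n, ← tsum_edgeLength_tail ε n, Finset.sum_eq_zero, zero_add]
  · refine ((summable_nat_add_iff n).2 hs).tsum_le_tsum (fun k => ?_)
      ((summable_nat_add_iff n).2 ((summable_edgeLength hε.out).mul_left 2))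
    have := edgeLength_pos ε (k + n)
    unfold edgeTerm
    split_ifs <;> linarith
  · intro k hk
    rw [edgeTerm, if_pos]
    exact vertex_eq_of_le hG (by simpa using hk) h

theorem le_dist_of_vertex_ne (hG : G.IsTree) {ζ ξ : Boundary G o ε} {n : ℕ}
    (h : ζ.vertex (n + 1) ≠ ξ.vertex (n + 1)) : bound ε * Real.exp (-ε) ^ n ≤ dist ζ ξ := by
  have hs := summable_edgeTerm hε.out ζ ξ
  rw [dist_eq_tsum, ← hs.sum_add_tsum_nat_add n, ← tsum_edgeLength_tail ε n]
  refine le_add_of_nonneg_of_le (Finset.sum_nonneg fun k _ => edgeTerm_nonneg ζ ξ k) ?_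
  refine ((summable_nat_add_iff n).2 ((summable_edgeLength hε.out).mul_left 2)).tsum_le_tsum
    (fun k => ?_) ((summable_nat_add_iff n).2 hs)
  rw [edgeTerm, if_neg]
  exact fun hk => h (vertex_eq_of_le hG (by omega) hk)

/-- An open ball whose radius lies strictly between two consecutive scales is a cylinder. -/
theorem ball_eq_cylinder (hG : G.IsTree) (ζ : Boundary G o ε) {n : ℕ} {t : ℝ}
    (ht : bound ε * Real.exp (-ε) ^ n < t)
    (ht' : t < bound ε * Real.exp (-ε) ^ n / Real.exp (-ε)) :
    Metric.ball ζ t = cylinder n ζ := by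
  ext ξ
  refine ⟨fun h => ?_, fun h => (dist_le_of_vertex_eq hG h).trans_lt ht⟩
  rw [cylinder, mem_ofPred_eq]
  cases n with
  | zero => rw [ζ.vertex_zero, ξ.vertex_zero]
  | succ n =>
    by_contra hne
    have h1 := le_dist_of_vertex_ne hG hne
    rw [pow_succ, ← mul_assoc, mul_div_cancel_right₀ _ (Real.exp_pos _).ne'] at ht'
    exact absurd (Metric.mem_ball.1 h) (not_lt.2 (ht'.le.trans h1))

theorem isOpen_cylinder (hG : G.IsTree) (n : ℕ) (ζ : Boundary G o ε) :
    IsOpen (cylinder n ζ) := by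
  obtain ⟨t, ht, ht'⟩ := exists_between (scale_lt_div hε.out n)
  rw [← ball_eq_cylinder hG ζ ht ht']
  exact Metric.isOpen_ball

/-- The vertices of a geodesic that starts at `x` and copies the geodesic `ζ`. -/
def copyVertex (e : V → V → V → V) (x : V) (ζ : Boundary G o ε) : ℕ → V
  | 0 => x
  | m + 1 => e (ζ.vertex m) (copyVertex e x ζ m) (ζ.vertex (m + 1))

/-- The map follows `ζ` to level `n` and then copies its argument below that vertex. Parting levels
shift by exactly `n`, so distances shrink by `exp (-n * ε)`. -/
theorem exists_antilipschitz (hK : 2 ≤ K) (hG : IsRegularTree G o K) (n : ℕ)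
    (ζ : Boundary G o ε) : ∃ ψ : Boundary G o ε → Boundary G o ε,
      AntilipschitzWith (Real.exp (n * ε)).toNNReal ψ ∧ ∀ ξ, ψ ξ ∈ cylinder n ζ := by
  obtain ⟨e, he⟩ := hG.exists_child_map hK
  have hchild : ∀ (ξ : Boundary G o ε) m, IsChild G o (copyVertex e (ζ.vertex n) ξ m)
      (copyVertex e (ζ.vertex n) ξ (m + 1)) := fun ξ m => (he _ _).1 _ (ξ.isChild m)
  have hinj : ∀ (ξ χ : Boundary G o ε) m,
      copyVertex e (ζ.vertex n) ξ m = copyVertex e (ζ.vertex n) χ m →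
      ξ.vertex m = χ.vertex m := by
    intro ξ χ m
    induction m with
    | zero => intro _; rw [ξ.vertex_zero, χ.vertex_zero]
    | succ m ih =>
      intro h
      -- Equal copies have equal parents; the induction hypothesis then reduces the claim to
      -- injectivity of a single child map.
      have h1 := (hchild ξ m).parent_unique hG.1 (h ▸ hchild χ m)
      have h2 := ih h1
      rw [copyVertex, copyVertex, h1, h2] at h
      exact (he _ _).2 (h2 ▸ ξ.isChild m) (χ.isChild m) h
  let ψ : Boundary G o ε → Boundary G o ε := fun ξ =>
    { vertex := fun k => if k ≤ n then ζ.vertex k else copyVertex e (ζ.vertex n) ξ (k - n)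
      vertex_zero := by simp [ζ.vertex_zero]
      isChild := by
        intro k
        rcases lt_trichotomy k n with hk | rfl | hk
        · rw [if_pos hk.le, if_pos (Nat.succ_le_of_lt hk)]
          exact ζ.isChild k
        · rw [if_pos le_rfl, if_neg (by omega), Nat.add_sub_cancel_left]
          exact hchild ξ 0
        · rw [if_neg (by omega), if_neg (by omega), Nat.sub_add_comm hk.le]
          exact hchild ξ _ }
  refine ⟨ψ, AntilipschitzWith.of_le_mul_dist fun ξ χ => ?_, fun ξ => ?_⟩
  · rcases eq_or_ne ξ χ with rfl | hne
    · simp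
    obtain ⟨m, hmin, hm⟩ := exists_vertex_ne hne
    have hψ : (ψ ξ).vertex (n + m + 1) ≠ (ψ χ).vertex (n + m + 1) := by
      intro h
      apply hm
      apply hinj
      simpa [ψ, add_assoc] using h
    rw [Real.coe_toNNReal _ (Real.exp_pos _).le]
    calc dist ξ χ ≤ bound ε * Real.exp (-ε) ^ m := dist_le_of_vertex_eq hG.1 hmin
      _ = Real.exp (n * ε) * (bound ε * Real.exp (-ε) ^ (n + m)) := by
        rw [pow_add, ← Real.exp_nat_mul (-ε) n, mul_left_comm, mul_neg,
          Real.exp_neg (n * ε), mul_inv_cancel_left₀ (Real.exp_pos _).ne']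
      _ ≤ Real.exp (n * ε) * dist (ψ ξ) (ψ χ) := by
        gcongr
        exact le_dist_of_vertex_ne hG.1 hψ
  · simp [cylinder, ψ]

/-- The Hausdorff measure of a cylinder of level `n` is at least `K⁻ⁿ` times that of `∂X`. -/
theorem hausdorffMeasure_univ_le (hK : 2 ≤ K) (hG : IsRegularTree G o K) {Q : ℝ}
    (hQ : Q = Real.log K / ε) (n : ℕ) (ζ : Boundary G o ε) :
    Measure.hausdorffMeasure Q (univ : Set (Boundary G o ε)) ≤
      (K : ℝ≥0∞) ^ n * Measure.hausdorffMeasure Q (cylinder n ζ) := by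
  obtain ⟨ψ, hψ, hmem⟩ := exists_antilipschitz hK hG n ζ
  have hK0 : (0 : ℝ) < K := by positivity
  have hQ0 : 0 ≤ Q := hQ ▸ div_nonneg (Real.log_natCast_nonneg K) hε.out.le
  have h := hψ.hausdorffMeasure_preimage_le hQ0 (cylinder n ζ)
  rw [show ψ ⁻¹' cylinder n ζ = univ from eq_univ_of_forall hmem] at h
  convert h using 2
  -- Since `ε * Q = log K`, the antilipschitz constant to the power `Q` is `K ^ n`.
  have h1 : (Real.exp (n * ε)).toNNReal ^ Q = (K : ℝ≥0) ^ n := by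
    rw [← NNReal.coe_inj, NNReal.coe_rpow, Real.coe_toNNReal _ (Real.exp_pos _).le, NNReal.coe_pow, NNReal.coe_natCast,
      ← Real.exp_mul, hQ, mul_assoc, mul_div_cancel₀ _ hε.out.ne', Real.exp_nat_mul,
      Real.exp_log hK0]
  rw [← ENNReal.coe_rpow_of_nonneg _ hQ0, h1]
  simp

end Metric

end Boundary

end RootedTree

/-! ### Jensen's inequality for averages -/

namespace Besov

open Filter Topology

/-- Jensen's inequality for the power `p` and an average. -/
theorem enorm_average_rpow_le {Ω : Type*} [MeasurableSpace Ω] {μ : Measure Ω} [IsFiniteMeasure μ]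
    [NeZero μ] {p : ℝ} (hp : 1 ≤ p) {g : Ω → ℝ} (hg : AEStronglyMeasurable g μ) :
    ‖⨍ x, g x ∂μ‖ₑ ^ p ≤ ⨍⁻ x, ‖g x‖ₑ ^ p ∂μ := by
  have hp0 : 0 < p := one_pos.trans_le hp
  have hg' : AEStronglyMeasurable g ((μ univ)⁻¹ • μ) := hg.smul_measure _
  have h1 : ‖∫ x, g x ∂(μ univ)⁻¹ • μ‖ₑ ≤ eLpNorm' g p ((μ univ)⁻¹ • μ) := by
    refine (enorm_integral_le_lintegral_enorm _).trans ?_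
    simpa [eLpNorm'] using eLpNorm'_le_eLpNorm'_of_exponent_le one_pos hp ((μ univ)⁻¹ • μ) hg'
  calc ‖⨍ x, g x ∂μ‖ₑ ^ p ≤ eLpNorm' g p ((μ univ)⁻¹ • μ) ^ p := ENNReal.rpow_le_rpow h1 hp0.le
    _ = ⨍⁻ x, ‖g x‖ₑ ^ p ∂μ := by
      rw [eLpNorm', ← ENNReal.rpow_mul, one_div_mul_cancel hp0.ne', ENNReal.rpow_one]
      rfl

theorem enorm_sub_average_rpow_le {Ω : Type*} [MeasurableSpace Ω] {μ : Measure Ω}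
    [IsFiniteMeasure μ] [NeZero μ] {p : ℝ} (hp : 1 ≤ p) {g : Ω → ℝ} (hg : Integrable g μ)
    (c : ℝ) : ‖c - ⨍ x, g x ∂μ‖ₑ ^ p ≤ ⨍⁻ x, ‖c - g x‖ₑ ^ p ∂μ := by
  have h : c - ⨍ x, g x ∂μ = ⨍ x, (c - g x) ∂μ := by
    have h1 : ⨍ x, (c - g x) ∂μ = (⨍ _, c ∂μ) - ⨍ x, g x ∂μ :=
      integral_sub (integrable_const c).to_average hg.to_average
    rw [h1, average_const]
  rw [h]
  exact enorm_average_rpow_le hp (aestronglyMeasurable_const.sub hg.1)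

end Besov

/-! ### Cylinder averages, oscillations and Hölder regularity -/

namespace RootedTree.Boundary

open Filter Topology Besov

variable {V : Type*} {G : SimpleGraph V} {o : V} {ε : ℝ} {K : ℕ}

theorem cylinder_congr {n : ℕ} {ζ ξ : Boundary G o ε} (h : ξ ∈ cylinder n ζ) :
    cylinder n ξ = cylinder n ζ := by
  ext χ
  rw [cylinder, cylinder, mem_ofPred_eq, mem_ofPred_eq, show ξ.vertex n = ζ.vertex n from h]

theorem mem_cylinder_self (n : ℕ) (ζ : Boundary G o ε) : ζ ∈ cylinder n ζ := rfl

variable [hε : Fact (0 < ε)]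

/-- The average of `u` over the cylinder of level `n` around `ζ`. -/
noncomputable def cylinderAverage (ν : Measure (Boundary G o ε)) (u : Boundary G o ε → ℝ) (n : ℕ)
    (ζ : Boundary G o ε) : ℝ :=
  ⨍ ξ in cylinder n ζ, u ξ ∂ν

/-- The mean oscillation of `u` of exponent `p` over the cylinders of level `n`. -/
noncomputable def oscillation (ν : Measure (Boundary G o ε)) (p : ℝ) (u : Boundary G o ε → ℝ)
    (n : ℕ) : ℝ≥0∞ :=
  ∫⁻ ζ, ⨍⁻ ξ in cylinder n ζ, ‖u ζ - u ξ‖ₑ ^ p ∂ν ∂ν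

variable {ν : Measure (Boundary G o ε)} {p : ℝ} {u : Boundary G o ε → ℝ}

theorem cylinderAverage_congr {n : ℕ} {ζ ξ : Boundary G o ε} (h : ξ.vertex n = ζ.vertex n) :
    cylinderAverage ν u n ξ = cylinderAverage ν u n ζ := by
  rw [cylinderAverage, cylinderAverage, cylinder_congr h]

theorem continuous_cylinderAverage (hG : G.IsTree) (n : ℕ) :
    Continuous (cylinderAverage ν u n) :=
  ((IsLocallyConstant.iff_exists_open _).2 fun ζ =>
    ⟨cylinder n ζ, isOpen_cylinder hG n ζ, mem_cylinder_self n ζ,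
      fun _ hξ => cylinderAverage_congr hξ⟩).continuous

theorem modulus_rpow_eq_oscillation (hG : G.IsTree) (hp : 0 < p) {n : ℕ} {t : ℝ}
    (ht : t ∈ Ioo (bound ε * Real.exp (-ε) ^ n) (bound ε * Real.exp (-ε) ^ n / Real.exp (-ε))) :
    modulus ν p u t ^ p = oscillation ν p u n := by
  rw [modulus, ← ENNReal.rpow_mul, one_div_mul_cancel hp.ne', ENNReal.rpow_one, oscillation]
  refine lintegral_congr fun ζ => ?_
  rw [ball_eq_cylinder hG ζ ht.1 ht.2]
  refine congrArg _ (funext fun ξ => ?_)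
  rw [Real.enorm_eq_ofReal_abs, ENNReal.ofReal_rpow_of_nonneg (abs_nonneg _) hp.le]

/-- The oscillations of a function with finite Besov seminorm decay geometrically. -/
theorem exists_oscillation_le (hG : G.IsTree) (hp : 0 < p) {θ : ℝ} (hθ : 0 ≤ θ)
    (hu : seminorm ν θ p p u < ∞) : ∃ M : ℝ, 0 ≤ M ∧
      ∀ n : ℕ, oscillation ν p u n ≤ ENNReal.ofReal (M * (Real.exp (-ε) ^ n) ^ (θ * p)) := by
  set q := Real.exp (-ε) with hq
  have hq0 : 0 < q := Real.exp_pos _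
  have hq1 : q < 1 := by simpa [hq] using hε.out
  have hD := bound_pos hε.out
  set F : ℝ → ℝ≥0∞ := fun t => (modulus ν p u t / ENNReal.ofReal (t ^ θ)) ^ p / ENNReal.ofReal t
    with hF
  set S : ℝ≥0∞ := ∫⁻ t in Ioi (0 : ℝ), F t with hS
  have hS' : S ≠ ∞ := by
    intro h
    rw [seminorm, ← hF, ← hS, h, ENNReal.top_rpow_of_pos (by positivity)] at hu
    exact lt_irrefl _ hu
  -- With `b = (bound ε / q) * q ^ n`, the integrand on `(a, b)` is at least the oscillation over `b
  -- ^ (θ * p) * b`, and the interval has length `b * (1 - q)`.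
  refine ⟨S.toReal * ((bound ε / q) ^ (θ * p) * (1 - q)⁻¹), by
    have := sub_pos.2 hq1
    positivity, fun n => ?_⟩
  set a := bound ε * q ^ n with ha
  have ha0 : 0 < a := by positivity
  set b := a / q with hb
  have hb0 : 0 < b := by positivity
  have hab : a < b := scale_lt_div hε.out n
  set W : ℝ := (b ^ θ) ^ p * b with hW
  have hW0 : 0 < W := by positivity
  have h1 : oscillation ν p u n / ENNReal.ofReal W * ENNReal.ofReal (b - a) ≤ S := by
    calc oscillation ν p u n / ENNReal.ofReal W * ENNReal.ofReal (b - a)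
        = ∫⁻ _ in Ioo a b, oscillation ν p u n / ENNReal.ofReal W := by
          rw [setLIntegral_const, Real.volume_Ioo]
      _ ≤ ∫⁻ t in Ioo a b, F t := by
          refine setLIntegral_mono' measurableSet_Ioo fun t ht => ?_
          have ht0 : 0 < t := ha0.trans ht.1
          have htθ : 0 < t ^ θ := Real.rpow_pos_of_pos ht0 θ
          simp only [hF]
          rw [ENNReal.div_rpow_of_nonneg _ _ hp.le, modulus_rpow_eq_oscillation hG hp ht,
            ENNReal.ofReal_rpow_of_pos htθ, ENNReal.div_eq_inv_mul, ENNReal.div_eq_inv_mul,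
            ENNReal.div_eq_inv_mul, ← mul_assoc, ← ENNReal.ofReal_inv_of_pos hW0,
            ← ENNReal.ofReal_inv_of_pos ht0, ← ENNReal.ofReal_inv_of_pos (by positivity),
            ← ENNReal.ofReal_mul (by positivity), ← mul_inv]
          gcongr
          rw [hW, mul_comm t]
          gcongr <;> exact ht.2.le
      _ ≤ S := lintegral_mono_set fun t ht => ha0.trans ht.1
  have hba : 0 < b - a := sub_pos.2 hab
  have h2 : oscillation ν p u n = oscillation ν p u n / ENNReal.ofReal W * ENNReal.ofReal (b - a) *
      ENNReal.ofReal (W / (b - a)) := by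
    rw [ENNReal.div_eq_inv_mul, ← ENNReal.ofReal_inv_of_pos hW0, mul_comm (ENNReal.ofReal _),
      mul_assoc, mul_assoc, ← ENNReal.ofReal_mul hba.le, ← ENNReal.ofReal_mul (by positivity),
      show W⁻¹ * ((b - a) * (W / (b - a))) = 1 by field_simp, ENNReal.ofReal_one, mul_one]
  have h3 : S.toReal * ((bound ε / q) ^ (θ * p) * (1 - q)⁻¹) * (q ^ n) ^ (θ * p) =
      S.toReal * (W / (b - a)) := by
    have e1 : b = bound ε / q * q ^ n := by rw [hb, ha]; ring
    have e2 : b - a = b * (1 - q) := by rw [hb]; field_simp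
    have e3 : (1 - q) ≠ 0 := (sub_pos.2 hq1).ne'
    rw [e2, hW, ← Real.rpow_mul hb0.le, e1, Real.mul_rpow (by positivity) (by positivity)]
    field_simp
  rw [h3, ENNReal.ofReal_mul ENNReal.toReal_nonneg, ENNReal.ofReal_toReal hS', h2]
  exact mul_le_mul_left h1 _

variable [IsFiniteMeasure ν]

theorem enorm_sub_cylinderAverage_le (hp : 1 ≤ p) (hu : Integrable u ν) {n : ℕ}
    {ζ : Boundary G o ε} (hpos : ν (cylinder n ζ) ≠ 0) (c : ℝ) :
    ‖c - cylinderAverage ν u n ζ‖ₑ ^ p ≤ ⨍⁻ ξ in cylinder n ζ, ‖c - u ξ‖ₑ ^ p ∂ν := by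
  have : NeZero (ν.restrict (cylinder n ζ)) := ⟨fun h => hpos (Measure.restrict_eq_zero.1 h)⟩
  exact enorm_sub_average_rpow_le hp hu.restrict c

theorem lintegral_sub_cylinderAverage_le (hp : 1 ≤ p) (hu : Integrable u ν)
    (hpos : ∀ n (ζ : Boundary G o ε), ν (cylinder n ζ) ≠ 0) (n : ℕ) :
    ∫⁻ ζ, ‖u ζ - cylinderAverage ν u n ζ‖ₑ ^ p ∂ν ≤ oscillation ν p u n :=
  lintegral_mono fun ζ => enorm_sub_cylinderAverage_le hp hu (hpos n ζ) (u ζ)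

/-- The level-`n` average is constant on the smaller cylinder, so Jensen bounds the step by a mean
of `‖u - u_n‖ₑ ^ p` there. Enlarging that integral to all of `∂X` costs only the factor `1 / ν`. -/
theorem cylinderAverage_step_le (hG : G.IsTree) (hp : 1 ≤ p) (hu : Integrable u ν)
    (hpos : ∀ n (ζ : Boundary G o ε), ν (cylinder n ζ) ≠ 0) (n : ℕ) (ζ : Boundary G o ε) :
    ‖cylinderAverage ν u n ζ - cylinderAverage ν u (n + 1) ζ‖ₑ ^ p ≤
      oscillation ν p u n / ν (cylinder (n + 1) ζ) := by
  have hsub : cylinder (n + 1) ζ ⊆ cylinder n ζ := fun ξ hξ => vertex_eq_of_le hG n.le_succ hξ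
  refine (enorm_sub_cylinderAverage_le hp hu (hpos (n + 1) ζ) _).trans ?_
  rw [setLAverage_eq]
  gcongr
  refine le_trans ?_ (setLIntegral_le_lintegral (cylinder (n + 1) ζ) _)
  refine setLIntegral_mono' (isOpen_cylinder hG _ _).measurableSet fun χ hχ => ?_
  rw [← cylinderAverage_congr (hsub hχ), ← enorm_neg, neg_sub]
  exact enorm_sub_cylinderAverage_le hp hu (hpos n χ) (u χ)

/-- If the cylinder averages of `u` converge geometrically and the oscillations of `u` tend to
zero, then `u` has a Hölder continuous representative. -/
theorem exists_memHolder_of_dist_le (hG : G.IsTree) (hp : 1 ≤ p) (hu : Integrable u ν)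
    (hpos : ∀ n (ζ : Boundary G o ε), ν (cylinder n ζ) ≠ 0)
    (hosc : Tendsto (oscillation ν p u) atTop (𝓝 0)) {α : ℝ≥0} (hα : 0 < α) {C : ℝ} (hC : 0 ≤ C)
    (h : ∀ ζ n, dist (cylinderAverage ν u n ζ) (cylinderAverage ν u (n + 1) ζ) ≤
      C * (Real.exp (-ε) ^ (α : ℝ)) ^ n) :
    ∃ v : Boundary G o ε → ℝ, v =ᵐ[ν] u ∧ MemHolder α v := by
  have hp0 : 0 < p := one_pos.trans_le hp
  set q := Real.exp (-ε) with hq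
  have hq0 : 0 < q := Real.exp_pos _
  have hq1 : q < 1 := by simpa [hq] using hε.out
  have hr1 : q ^ (α : ℝ) < 1 := Real.rpow_lt_one hq0.le hq1 hα
  have hlim : ∀ ζ, ∃ y, Tendsto (fun n => cylinderAverage ν u n ζ) atTop (𝓝 y) := fun ζ =>
    cauchySeq_tendsto_of_complete (cauchySeq_of_le_geometric _ _ hr1 (h ζ))
  choose v hv using hlim
  refine ⟨v, ?_, ?_⟩
  · have h1 : ∫⁻ ζ, ‖u ζ - v ζ‖ₑ ^ p ∂ν = 0 := by
      refine le_antisymm ?_ zero_le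
      calc ∫⁻ ζ, ‖u ζ - v ζ‖ₑ ^ p ∂ν
          = ∫⁻ ζ, liminf (fun n => ‖u ζ - cylinderAverage ν u n ζ‖ₑ ^ p) atTop ∂ν := by
            refine lintegral_congr fun ζ => (Tendsto.liminf_eq ?_).symm
            exact ((tendsto_const_nhds.sub (hv ζ)).enorm).ennrpow_const p
        -- Fatou's lemma.
        _ ≤ liminf (fun n => ∫⁻ ζ, ‖u ζ - cylinderAverage ν u n ζ‖ₑ ^ p ∂ν) atTop :=
            lintegral_liminf_le' fun n => ((hu.1.sub
              (continuous_cylinderAverage hG n).aestronglyMeasurable).enorm).pow_const p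
        _ ≤ liminf (oscillation ν p u) atTop :=
            liminf_le_liminf (Eventually.of_forall
              (lintegral_sub_cylinderAverage_le hp hu hpos))
        _ = 0 := hosc.liminf_eq
    have hmeas : AEMeasurable v ν := aemeasurable_of_tendsto_metrizable_ae' (f := fun n =>
      cylinderAverage ν u n) (fun n => (continuous_cylinderAverage hG n).aemeasurable)
      (Eventually.of_forall hv)
    replace h1 := (lintegral_eq_zero_iff' (((hu.1.aemeasurable.sub hmeas).enorm).pow_const p)).1 h1
    filter_upwards [h1] with ζ hζ
    have h2 : ‖u ζ - v ζ‖ₑ = 0 := by simpa [hp0, hp0.not_gt] using hζ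
    exact (sub_eq_zero.1 (enorm_eq_zero.1 h2)).symm
  · have hD := bound_pos hε.out
    -- Two geometric tails `C * r ^ n / (1 - r)` with `r = q ^ α`, rescaled by `r ^ n = (bound ε * q
    -- ^ n) ^ α / bound ε ^ α`.
    set B : ℝ := 2 * (C / (1 - q ^ (α : ℝ))) / bound ε ^ (α : ℝ) with hB
    have hB0 : 0 ≤ B := by
      have := sub_pos.2 hr1
      positivity
    have key : ∀ ζ ξ, dist (v ζ) (v ξ) ≤ B * dist ζ ξ ^ (α : ℝ) := by
      intro ζ ξ
      rcases eq_or_ne ζ ξ with rfl | hne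
      · rw [dist_self, dist_self]
        positivity
      obtain ⟨n, hn, hn'⟩ := exists_vertex_ne hne
      have h1 := dist_le_of_le_geometric_of_tendsto _ _ hr1 (h ζ) (hv ζ) n
      have h2 := dist_le_of_le_geometric_of_tendsto _ _ hr1 (h ξ) (hv ξ) n
      -- Both points lie in the same cylinder of level `n`, so one average serves as the
      -- intermediate value.
      rw [← cylinderAverage_congr hn] at h2
      have h3 : (bound ε * q ^ n) ^ (α : ℝ) ≤ dist ζ ξ ^ (α : ℝ) :=
        Real.rpow_le_rpow (by positivity) (le_dist_of_vertex_ne hG hn') α.2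
      calc dist (v ζ) (v ξ) ≤ 2 * (C * (q ^ (α : ℝ)) ^ n / (1 - q ^ (α : ℝ))) := by
            have := dist_triangle_left (v ζ) (v ξ) (cylinderAverage ν u n ζ)
            linarith
        _ = B * (bound ε * q ^ n) ^ (α : ℝ) := by
            rw [Real.mul_rpow hD.le (by positivity), ← Real.rpow_pow_comm hq0.le, hB]
            field_simp
        _ ≤ B * dist ζ ξ ^ (α : ℝ) := by gcongr
    refine ⟨B.toNNReal, fun ζ ξ => ?_⟩
    rw [edist_dist, edist_dist, ENNReal.ofReal_rpow_of_nonneg dist_nonneg α.coe_nonneg,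
      ← ENNReal.ofReal, ← ENNReal.ofReal_mul hB0]
    exact ENNReal.ofReal_le_ofReal (key ζ ξ)

/-- Dividing by the measure of a cylinder costs `K ^ (n + 1)`; as `K = q ^ (-Q)`, this lowers the
decay exponent from `θ` to `θ - Q / p`. -/
theorem exists_memHolder_of_seminorm_lt_top (hG : G.IsTree) (hp : 1 ≤ p) (hu : Integrable u ν)
    (hK : 0 < K) {Q : ℝ} (hQ : Q = Real.log K / ε)
    (hν : ∀ n (ζ : Boundary G o ε), 1 ≤ (K : ℝ≥0∞) ^ n * ν (cylinder n ζ))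
    {θ : ℝ} {α : ℝ≥0} (hα : 0 < α) (hαθ : α ≤ θ - Q / p) (hsemi : seminorm ν θ p p u < ∞) :
    ∃ v : Boundary G o ε → ℝ, v =ᵐ[ν] u ∧ MemHolder α v := by
  have hp0 : 0 < p := one_pos.trans_le hp
  have hK0 : (0 : ℝ) < K := Nat.cast_pos.2 hK
  have hQ0 : 0 ≤ Q := hQ ▸ div_nonneg (Real.log_natCast_nonneg K) hε.out.le
  have hα' : (0 : ℝ) < α := hα
  have hθ : 0 < θ := by
    have := div_nonneg hQ0 hp0.le
    linarith
  obtain ⟨M, hM, hosc⟩ := exists_oscillation_le hG hp0 hθ.le hsemi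
  set q := Real.exp (-ε) with hq
  have hq0 : 0 < q := Real.exp_pos _
  have hq1 : q < 1 := by simpa [hq] using hε.out
  have hpos : ∀ n (ζ : Boundary G o ε), ν (cylinder n ζ) ≠ 0 := by
    intro n ζ h0
    have := hν n ζ
    simp [h0] at this
  have hKq : (K : ℝ) = q ^ (-Q) := by
    rw [hq, ← Real.exp_mul, neg_mul_neg, hQ, mul_div_cancel₀ _ hε.out.ne', Real.exp_log hK0]
  refine exists_memHolder_of_dist_le hG hp hu hpos ?_ hα (C := (K * M) ^ (1 / p)) (by positivity)
    fun ζ n => ?_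
  · have hlim : Tendsto (fun n : ℕ => ENNReal.ofReal (M * (q ^ n) ^ (θ * p))) atTop (𝓝 0) := by
      have h1 : Tendsto (fun n : ℕ => M * (q ^ (θ * p)) ^ n) atTop (𝓝 (M * 0)) :=
        (tendsto_pow_atTop_nhds_zero_of_lt_one (by positivity)
          (Real.rpow_lt_one hq0.le hq1 (by positivity))).const_mul M
      rw [mul_zero] at h1
      simpa [Real.rpow_pow_comm hq0.le] using ENNReal.tendsto_ofReal h1
    exact tendsto_of_tendsto_of_tendsto_of_le_of_le tendsto_const_nhds hlim (fun _ => zero_le) hosc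
  · have h1 : ‖cylinderAverage ν u n ζ - cylinderAverage ν u (n + 1) ζ‖ₑ ^ p ≤
        ENNReal.ofReal (K ^ (n + 1) * (M * (q ^ n) ^ (θ * p))) := by
      calc ‖cylinderAverage ν u n ζ - cylinderAverage ν u (n + 1) ζ‖ₑ ^ p
          ≤ oscillation ν p u n / ν (cylinder (n + 1) ζ) :=
            cylinderAverage_step_le hG hp hu hpos n ζ
        _ ≤ (K : ℝ≥0∞) ^ (n + 1) * oscillation ν p u n := by
            refine ENNReal.div_le_of_le_mul' ?_
            calc oscillation ν p u n = 1 * oscillation ν p u n := (one_mul _).symm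
              _ ≤ (K : ℝ≥0∞) ^ (n + 1) * ν (cylinder (n + 1) ζ) * oscillation ν p u n := by
                gcongr
                exact hν _ _
              _ = _ := by ring
        _ ≤ (K : ℝ≥0∞) ^ (n + 1) * ENNReal.ofReal (M * (q ^ n) ^ (θ * p)) := by
            gcongr
            exact hosc n
        _ = _ := by
            rw [ENNReal.ofReal_mul (p := (K : ℝ) ^ (n + 1)) (by positivity),
              ENNReal.ofReal_pow hK0.le,
              ENNReal.ofReal_natCast]
    rw [Real.enorm_eq_ofReal_abs, ENNReal.ofReal_rpow_of_nonneg (abs_nonneg _) hp0.le,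
      ENNReal.ofReal_le_ofReal_iff (by positivity), ← Real.dist_eq] at h1
    have h2 : (K : ℝ) ^ (n + 1) * (M * (q ^ n) ^ (θ * p)) ≤ K * M * (q ^ n) ^ (α * p) := by
      have h3 : (K : ℝ) ^ n * (q ^ n) ^ (θ * p) ≤ (q ^ n) ^ (α * p) := by
        rw [hKq, Real.rpow_pow_comm hq0.le, ← Real.rpow_add (by positivity)]
        -- The base `q ^ n` is at most `1`, so the larger exponent `θ * p - Q ≥ α * p` gives the
        -- smaller power.
        refine Real.rpow_le_rpow_of_exponent_ge (by positivity)
          (pow_le_one₀ hq0.le hq1.le) ?_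
        have := mul_le_mul_of_nonneg_right hαθ hp0.le
        rw [sub_mul, div_mul_cancel₀ _ hp0.ne'] at this
        linarith
      calc (K : ℝ) ^ (n + 1) * (M * (q ^ n) ^ (θ * p))
          = K * M * (K ^ n * (q ^ n) ^ (θ * p)) := by ring
        _ ≤ _ := by gcongr
    rw [← Real.rpow_le_rpow_iff dist_nonneg (by positivity) hp0,
      Real.mul_rpow (by positivity) (by positivity), ← Real.rpow_mul (by positivity),
      one_div_mul_cancel hp0.ne', Real.rpow_one, Real.rpow_pow_comm hq0.le,
      ← Real.rpow_mul (by positivity)]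
    exact h1.trans h2

end RootedTree.Boundary

/-! ### Normalization and the three cases -/

theorem RootedTree.Boundary.one_le_mul_measure_cylinder {V : Type*} {G : SimpleGraph V} {o : V}
    {K : ℕ} {ε : ℝ} [Fact (0 < ε)] (hK : 2 ≤ K) (hG : IsRegularTree G o K) {Q : ℝ}
    (hQ : Q = Real.log K / ε)
    (h0 : Measure.hausdorffMeasure Q (univ : Set (Boundary G o ε)) ≠ 0)
    (htop : Measure.hausdorffMeasure Q (univ : Set (Boundary G o ε)) ≠ ∞)
    (n : ℕ) (ζ : Boundary G o ε) :
    1 ≤ (K : ℝ≥0∞) ^ n * Besov.normalizedHausdorff (Boundary G o ε) Q (cylinder n ζ) := by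
  rw [Besov.normalizedHausdorff, Measure.smul_apply, smul_eq_mul, mul_left_comm,
    ← ENNReal.inv_mul_cancel h0 htop]
  gcongr
  exact hausdorffMeasure_univ_le hK hG hQ n ζ

theorem proposition6p5 {V : Type*} (G : SimpleGraph V) (o : V) (K : ℕ) (hK : 2 ≤ K)
    (hG : RootedTree.IsRegularTree G o K) (ε : ℝ) [Fact (0 < ε)]
    (Q : ℝ) (hQ : Q = Real.log K / ε) (ν : MeasureTheory.Measure (RootedTree.Boundary G o ε))
    (hν : ν = Besov.normalizedHausdorff (RootedTree.Boundary G o ε) Q)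
    (p : ℝ) (hp : 1 < p) (θ : ℝ) (α : NNReal)
    (h : (Q < 1 ∧ (Q - 1) / p + 1 ≤ θ ∧ (α : ℝ) = 1 - 1 / p) ∨
      (Q / p < θ ∧ θ ≤ (Q - 1) / p + 1 ∧ θ < 1 ∧ (α : ℝ) = θ - Q / p) ∨
      (1 ≤ Q ∧ 1 ≤ θ ∧ 0 < (α : ℝ) ∧ (α : ℝ) < 1 - Q / p))
    (u : RootedTree.Boundary G o ε → ℝ) (hu : Besov.MemBesov ν θ p p u) :
    ∃ v : RootedTree.Boundary G o ε → ℝ, v =ᵐ[ν] u ∧ MemHolder α v := by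
  -- The normalization is a probability measure unless the Hausdorff measure is degenerate, in
  -- which case `ν = 0`.
  rcases eq_or_ne ν 0 with rfl | hν0
  · exact ⟨0, by simp [Filter.EventuallyEq], memHolder_zero⟩
  have h0 : Measure.hausdorffMeasure Q (univ : Set (RootedTree.Boundary G o ε)) ≠ 0 := by
    intro h0
    apply hν0
    rw [hν, Besov.normalizedHausdorff, Measure.measure_univ_eq_zero.1 h0, smul_zero]
  have htop : Measure.hausdorffMeasure Q (univ : Set (RootedTree.Boundary G o ε)) ≠ ∞ := by
    intro htop
    apply hν0
    rw [hν, Besov.normalizedHausdorff, htop, ENNReal.inv_top, zero_smul]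
  have hprob : IsProbabilityMeasure ν :=
    ⟨by rw [hν, Besov.normalizedHausdorff, Measure.smul_apply, smul_eq_mul,
      ENNReal.inv_mul_cancel h0 htop]⟩
  have hp0 : 0 < p := one_pos.trans hp
  have hint : Integrable u ν :=
    hu.1.integrable (by rw [← ENNReal.ofReal_one]; exact ENNReal.ofReal_le_ofReal hp.le)
  -- The three cases enter only here. In (a) the bound on `θ` rearranges to `1 - 1 / p ≤ θ - Q / p`,
  -- (b) is an equality, and (c) uses `1 ≤ θ`.
  have hα : 0 < (α : ℝ) ∧ (α : ℝ) ≤ θ - Q / p := by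
    rcases h with ⟨-, h1, h2⟩ | ⟨h1, -, -, h2⟩ | ⟨-, h1, h2, h3⟩
    · have : 1 / p < 1 := (div_lt_one hp0).2 hp
      rw [sub_div] at h1
      constructor <;> linarith
    · constructor <;> linarith
    · constructor <;> linarith
  subst hν
  exact RootedTree.Boundary.exists_memHolder_of_seminorm_lt_top hG.1 hp.le hint (by omega) hQ
    (RootedTree.Boundary.one_le_mul_measure_cylinder hK hG hQ h0 htop) hα.1 hα.2 hu.2
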